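/- Let $f\colon\mathbb{R}^n\to(-\infty,\infty]$, let $U\subset\mathbb{R}^n$ be open, and let $L>0$. Suppose that $f$ is differentiable (in particular, finite) at every point of $U$ and that its gradient satisfies $\|\nabla f(x)-\nabla f(y)\|\le L\|x-y\|$ for all $x,y\in U$ (Euclidean norm). Notation. For $x\in U$, $v,w\in\mathbb{R}^n$ and $t>0$ put $$\Delta_t^2 f(x|v)(w):=\frac{f(x+tw)-f(x)-t\langle v,w\rangle}{\tfrac12 t^2},\qquad d^2f(x|v)(w):=\liminf_{t\downarrow 0,\;w'\to w}\Delta_t^2 f(x|v)(w')\in[-\infty,\infty].$$ The function $f$ is \emph{twice epi-differentiable} at $x$ for $v$ if the functions $\Delta_t^2 f(x|v)$ epi-converge to $d^2f(x|v)$ as $t\downarrow 0$, i.e. the outer and the inner (Painlevé–Kuratowski) limits of their epigraphs as $t\downarrow0$ both equal the epigraph of $d^2f(x|v)$. A function $q\colon\mathbb{R}^n\to(-\infty,\infty]$ is a \emph{generalized quadratic form} if there are a symmetric matrix $A\in\mathbb{R}^{n\times n}$ and a linear subspace $M\subset\mathbb{R}^n$ such that $q(w)=\tfrac12\langle w,Aw\rangle$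 for $w\in M$ and $q(w)=\infty$ for $w\notin M$. The function $f$ is \emph{generalized twice differentiable} at $x$ for $v$ if $v$ belongs to the limiting (Mordukhovich) subdifferential $\partial f(x)$, $f$ is twice epi-differentiable at $x$ for $v$, and $d^2f(x|v)$ is a generalized quadratic form. It is \emph{twice differentiable at $x$ in the classical sense} if it is differentiable on a neighborhood of $x$ and $\nabla f$ is differentiable at $x$. Then the following hold. (i) For all $x\in U$ and $w\in\mathbb{R}^n$, the value $d^2f(x|\nabla f(x))(w)$ is finite and $$\big|d^2f(x|\nabla f(x))(w)\big|\le L\|w\|^2 .$$ (ii) For every $x\in U$, $f$ is generalized twice differentiable at $x$ for $\nabla f(x)$ if and only if $f$ is twice differentiable at $x$ in the classical sense. -/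

import Mathlib

open Filter Topology

namespace VarAnalysis

/-- The space `ℝⁿ` with its Euclidean norm and inner product. -/
abbrev Rn (n : ℕ) : Type := EuclideanSpace ℝ (Fin n)

/-! Extended-real-valued functions are functions `Rn n → EReal`; the convention that they do not
take the value `-∞` is a hypothesis of the theorem. -/

/-! ## Epi-convergence -/

/-- The epigraph of `g`, a subset of `ℝⁿ × ℝ`. -/
def epigraph {n : ℕ} (g : Rn n → EReal) : Set (Rn n × ℝ) :=
  {p | g p.1 ≤ (p.2 : EReal)}

/-- The outer (Painlevé–Kuratowski) limit of a family of sets along a filter: the limits of points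
that are taken from `C t` for a cofinal choice of `t`. -/
def outerLimit {T X : Type*} [TopologicalSpace X] (l : Filter T) (C : T → Set X) : Set X :=
  {x | ∀ V ∈ 𝓝 x, ∃ᶠ t in l, (C t ∩ V).Nonempty}

/-- The inner (Painlevé–Kuratowski) limit of a family of sets along a filter. -/
def innerLimit {T X : Type*} [TopologicalSpace X] (l : Filter T) (C : T → Set X) : Set X :=
  {x | ∀ V ∈ 𝓝 x, ∀ᶠ t in l, (C t ∩ V).Nonempty}

/-- The family `F t` epi-converges to `g` along `l`: the outer and the inner limit of the
epigraphs of the `F t` both coincide with the epigraph of `g`. -/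
def EpiTendsto {n : ℕ} {T : Type*} (F : T → Rn n → EReal) (l : Filter T) (g : Rn n → EReal) :
    Prop :=
  outerLimit l (fun t => epigraph (F t)) = epigraph g ∧
    innerLimit l (fun t => epigraph (F t)) = epigraph g

/-! ## Second subderivatives and twice epi-differentiability -/

/-- The second-order difference quotient
`Δ_t² f(x|v)(w) = (f(x + t w) - f(x) - t ⟨v, w⟩) / (t² / 2)`. -/
noncomputable def secondQuotient {n : ℕ} (f : Rn n → EReal) (x v : Rn n) (t : ℝ) (w : Rn n) :
    EReal :=
  (f (x + t • w) - f x - ((t * inner ℝ v w : ℝ) : EReal)) / (((1 / 2) * t ^ 2 : ℝ) : EReal)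

/-- The second subderivative `d² f(x|v)(w)`: the lower limit of `Δ_t² f(x|v)(w')` as `t ↓ 0` and
`w' → w`. -/
noncomputable def secondSubderiv {n : ℕ} (f : Rn n → EReal) (x v : Rn n) (w : Rn n) : EReal :=
  liminf (fun p : ℝ × Rn n => secondQuotient f x v p.1 p.2) (𝓝[>] (0 : ℝ) ×ˢ 𝓝 w)

/-- `f` is twice epi-differentiable at `x` for `v`: the second-order difference quotients
epi-converge, as `t ↓ 0`, to the second subderivative. -/
def TwiceEpiDifferentiableAt {n : ℕ} (f : Rn n → EReal) (x v : Rn n) : Prop :=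
  EpiTendsto (secondQuotient f x v) (𝓝[>] (0 : ℝ)) (secondSubderiv f x v)

/-! ## The subdifferential -/

/-- `v` is a regular (Fréchet) subgradient of `f` at the point `x` of its domain. -/
def IsRegularSubgradient {n : ℕ} (f : Rn n → EReal) (x v : Rn n) : Prop :=
  f x ≠ ⊤ ∧
    0 ≤ liminf (fun y : Rn n =>
      (f y - f x - ((inner ℝ v (y - x) : ℝ) : EReal)) / ((‖y - x‖ : ℝ) : EReal)) (𝓝[≠] x)

/-- The limiting (Mordukhovich) subdifferential of `f` at the point `x` of its domain: the limits
of regular subgradients at points converging to `x`. (It is only used at points around which `f`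
is continuous, where the condition `f (x_k) → f x` is automatic.) -/
def limitingSubdifferential {n : ℕ} (f : Rn n → EReal) (x : Rn n) : Set (Rn n) :=
  {v | f x ≠ ⊤ ∧ ∃ xs vs : ℕ → Rn n, Tendsto xs atTop (𝓝 x) ∧ Tendsto vs atTop (𝓝 v) ∧
    ∀ k, IsRegularSubgradient f (xs k) (vs k)}

/-! ## Generalized twice differentiability -/

open Classical in
/-- The indicator function `δ_S`, equal to `0` on `S` and to `∞` outside. -/
noncomputable def indicatorFun {n : ℕ} (S : Set (Rn n)) (w : Rn n) : EReal :=
  if w ∈ S then 0 else ⊤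

/-- `q` is a generalized quadratic form: `q = (1/2) ⟨·, A ·⟩ + δ_M` for a symmetric matrix `A` and
a linear subspace `M`. -/
def IsGeneralizedQuadraticForm {n : ℕ} (q : Rn n → EReal) : Prop :=
  ∃ (A : Matrix (Fin n) (Fin n) ℝ) (M : Submodule ℝ (Rn n)), A.IsSymm ∧
    ∀ w, q w = (((1 / 2) * inner ℝ w (Matrix.toEuclideanLin A w) : ℝ) : EReal) +
      indicatorFun (M : Set (Rn n)) w

/-- `f` is generalized twice differentiable at `x` for `v`, where `v` is a subgradient of `f`
at `x`. -/
def GeneralizedTwiceDifferentiableAt {n : ℕ} (f : Rn n → EReal) (x v : Rn n) : Prop :=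
  v ∈ limitingSubdifferential f x ∧ TwiceEpiDifferentiableAt f x v ∧
    IsGeneralizedQuadraticForm (secondSubderiv f x v)

/-! ## Classical differentiability of extended-real-valued functions -/

/-- `f` is differentiable at `x`: it is finite around `x`, and differentiable at `x` as a
real-valued function. -/
def DiffAt {n : ℕ} (f : Rn n → EReal) (x : Rn n) : Prop :=
  (∀ᶠ y in 𝓝 x, f y ≠ ⊥ ∧ f y ≠ ⊤) ∧ DifferentiableAt ℝ (fun y => (f y).toReal) x

/-- The gradient `∇f(x)` (meaningful where `f` is differentiable). -/
noncomputable def grad {n : ℕ} (f : Rn n → EReal) (x : Rn n) : Rn n :=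
  gradient (fun y => (f y).toReal) x

/-- `f` is twice differentiable at `x` in the classical sense: it is differentiable around `x`, and
its gradient mapping is differentiable at `x`. -/
def TwiceDiffAt {n : ℕ} (f : Rn n → EReal) (x : Rn n) : Prop :=
  (∀ᶠ y in 𝓝 x, DiffAt f y) ∧ DifferentiableAt ℝ (grad f) x

end VarAnalysis

/-!
Write `g` for the real-valued function underlying `f` and `G = ∇f`. The difference quotients `Δ_t`
of `f` at `x` for `G x` have gradients `(2 / t) (G (x + t w) - G x)`, which are Lipschitz in `w` with
constant `2 L`, so the whole family is of class `C^{1,1}` uniformly in `t`.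

The descent lemma `abs_sub_sub_inner_le_of_lipschitz` gives `|Δ_t(w)| ≤ L ‖w‖²`, and the bound passes
to the lower limit (`exists_secondSubderiv_eq_coe`). In particular the second subderivative is
finite, so when it is a generalized quadratic form it is `⟨H w, w⟩` with `H` symmetric, on the whole
space.

If `f` is twice epi-differentiable, the uniform Lipschitz bound on the `Δ_t` turns epi-convergence
into continuous convergence (`TwiceEpiDifferentiableAt.tendsto_realQuotient`), hence into uniform
convergence on the unit sphere, which is a second-order Taylor expansion of `g` at `x`. For functions
with Lipschitz gradient such an expansion can be differentiated, by interpolating the size of the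
gradient of the remainder between the size of the remainder and its Lipschitz constant
(`hasFDerivAt_gradient_of_taylor`).

Conversely, if `G` is differentiable at `x`, integrating along segments gives the Taylor expansion;
then the `Δ_t` converge continuously to the Hessian form, and continuous convergence implies
epi-convergence (`epiTendsto_of_tendsto_prod`).
-/

namespace VarAnalysis

/-! ### Taylor estimates for functions with a Lipschitz gradient -/

theorem add_smul_mem_ball {E : Type*} [NormedAddCommGroup E] [NormedSpace ℝ E] {x a d : E} {r : ℝ}
    (ha : a ∈ Metric.ball x r) (hd : a + d ∈ Metric.ball x r) {s : ℝ}
    (hs : s ∈ Set.Icc (0 : ℝ) 1) : a + s • d ∈ Metric.ball x r := by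
  simpa using (convex_ball x r).add_smul_sub_mem ha hd hs

section Taylor

variable {E : Type*} [NormedAddCommGroup E] [InnerProductSpace ℝ E] [CompleteSpace E]

/-- A second-order Taylor estimate along a segment, with the remainder controlled by the deviation
of the gradient from its linearization `H`. The constant `C / 2` comes from integrating the
derivative bound `C s ‖d‖²` over `[0, 1]`. -/
theorem abs_taylor_le_of_norm_gradient_sub_le {g : E → ℝ} {G : E → E} {a d : E} (H : E →L[ℝ] E)
    {C : ℝ} (hg : ∀ s ∈ Set.Icc (0 : ℝ) 1, HasGradientAt g (G (a + s • d)) (a + s • d))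
    (hC : ∀ s ∈ Set.Icc (0 : ℝ) 1, ‖G (a + s • d) - G a - s • H d‖ ≤ C * s * ‖d‖) :
    |g (a + d) - g a - inner ℝ (G a) d - (1 / 2) * inner ℝ (H d) d| ≤ C / 2 * ‖d‖ ^ 2 := by
  have hderiv : ∀ s ∈ Set.Icc (0 : ℝ) 1, HasDerivAt
      (fun s : ℝ => g (a + s • d) - g a - s * inner ℝ (G a) d
        - s ^ 2 / 2 * inner ℝ (H d) d)
      (inner ℝ (G (a + s • d) - G a - s • H d) d) s := by
    intro s hs
    have hline : HasDerivAt (fun s : ℝ => a + s • d) d s := by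
      simpa using ((hasDerivAt_id s).smul_const d).const_add a
    have h1 := (hg s hs).hasFDerivAt.comp_hasDerivAt s hline
    have h2 := ((h1.sub_const (g a)).sub
      ((hasDerivAt_id s).mul_const (inner ℝ (G a) d))).sub
      ((((hasDerivAt_id s).pow 2).div_const 2).mul_const (inner ℝ (H d) d))
    refine h2.congr_deriv ?_
    simp only [InnerProductSpace.toDual_apply_apply, inner_sub_left, real_inner_smul_left, id]
    ring
  have hB : ∀ s : ℝ, HasDerivAt (fun s : ℝ => C / 2 * s ^ 2 * ‖d‖ ^ 2) (C * s * ‖d‖ ^ 2) s := by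
    intro s
    have h := (((hasDerivAt_id s).pow 2).const_mul (C / 2)).mul_const (‖d‖ ^ 2)
    refine h.congr_deriv ?_
    simp only [id]
    ring
  have key := image_norm_le_of_norm_deriv_right_le_deriv_boundary (a := (0 : ℝ)) (b := 1)
    (fun s hs => (hderiv s hs).continuousAt.continuousWithinAt)
    (fun s hs => (hderiv s (Set.Ico_subset_Icc_self hs)).hasDerivWithinAt)
    (B := fun s : ℝ => C / 2 * s ^ 2 * ‖d‖ ^ 2) (by simp) hB
    (fun s hs => by
      calc ‖inner ℝ (G (a + s • d) - G a - s • H d) d‖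
          ≤ ‖G (a + s • d) - G a - s • H d‖ * ‖d‖ := norm_inner_le_norm _ _
        _ ≤ C * s * ‖d‖ * ‖d‖ := by
            gcongr
            exact hC s (Set.Ico_subset_Icc_self hs)
        _ = C * s * ‖d‖ ^ 2 := by ring)
    (Set.right_mem_Icc.2 zero_le_one)
  simpa using key

variable {g : E → ℝ} {G : E → E} {x : E} {r L : ℝ}

/-- The descent lemma, in its two-sided form. -/
theorem abs_sub_sub_inner_le_of_lipschitz (hg : ∀ y ∈ Metric.ball x r, HasGradientAt g (G y) y)
    (hG : ∀ y ∈ Metric.ball x r, ∀ z ∈ Metric.ball x r, ‖G y - G z‖ ≤ L * ‖y - z‖)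
    {a d : E} (ha : a ∈ Metric.ball x r) (hd : a + d ∈ Metric.ball x r) :
    |g (a + d) - g a - inner ℝ (G a) d| ≤ L / 2 * ‖d‖ ^ 2 := by
  have h := abs_taylor_le_of_norm_gradient_sub_le (g := g) (G := G) (a := a) (d := d) 0 (C := L)
    (fun s hs => hg _ (add_smul_mem_ball ha hd hs))
    (fun s hs => by
      have := hG _ (add_smul_mem_ball ha hd hs) a ha
      simpa [norm_smul, abs_of_nonneg hs.1, mul_assoc] using this)
  simpa using h

/-- On a ball of radius `ρ` about `x`, the function `g` differs from its linearization at `x` by a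
function with Lipschitz constant `L ρ`. -/
theorem abs_sub_sub_inner_center_le (hL : 0 ≤ L)
    (hg : ∀ y ∈ Metric.ball x r, HasGradientAt g (G y) y)
    (hG : ∀ y ∈ Metric.ball x r, ∀ z ∈ Metric.ball x r, ‖G y - G z‖ ≤ L * ‖y - z‖)
    {ρ : ℝ} (hρ : ρ ≤ r) {a b : E} (ha : a ∈ Metric.ball x ρ) (hb : b ∈ Metric.ball x ρ) :
    |g b - g a - inner ℝ (G x) (b - a)| ≤ L * ρ * ‖b - a‖ := by
  have hsub : Metric.ball x ρ ⊆ Metric.ball x r := Metric.ball_subset_ball hρ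
  have hx : x ∈ Metric.ball x r :=
    Metric.mem_ball_self ((dist_nonneg.trans_lt ha).trans_le hρ)
  have h := (convex_ball x ρ).norm_image_sub_le_of_norm_hasFDerivWithin_le' (f := g)
    (f' := fun y => InnerProductSpace.toDual ℝ E (G y)) (φ := InnerProductSpace.toDual ℝ E (G x))
    (C := L * ρ) (fun y hy => (hg y (hsub hy)).hasFDerivAt.hasFDerivWithinAt)
    (fun y hy => by
      rw [← map_sub, LinearIsometryEquiv.norm_map]
      refine (hG y (hsub hy) x hx).trans ?_
      gcongr
      exact (mem_ball_iff_norm.1 hy).le) ha hb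
  simpa using h

/-- If the gradient is differentiable at `x` with derivative `H`, then `g` has the second-order
Taylor expansion with Hessian `H` at `x`. -/
theorem taylor_isLittleO_of_hasFDerivAt_gradient (hr : 0 < r)
    (hg : ∀ y ∈ Metric.ball x r, HasGradientAt g (G y) y) {H : E →L[ℝ] E}
    (hH : HasFDerivAt G H x) :
    ∀ ε > 0, ∀ᶠ d in 𝓝 (0 : E),
      |g (x + d) - g x - inner ℝ (G x) d - (1 / 2) * inner ℝ (H d) d| ≤ ε * ‖d‖ ^ 2 := by
  intro ε hε
  have h := hasFDerivAt_iff_isLittleO_nhds_zero.1 hH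
  have h2 := h.def (c := ε) hε
  obtain ⟨ρ, hρ, h3⟩ := Metric.eventually_nhds_iff_ball.1 h2
  filter_upwards [Metric.ball_mem_nhds (0 : E) (lt_min hρ hr)] with d hd
  have hdn : ‖d‖ < min ρ r := by simpa using hd
  have hs' : ∀ s ∈ Set.Icc (0 : ℝ) 1, ‖s • d‖ ≤ ‖d‖ := by
    intro s hs
    rw [norm_smul, Real.norm_of_nonneg hs.1]
    exact mul_le_of_le_one_left (norm_nonneg _) hs.2
  have h4 := abs_taylor_le_of_norm_gradient_sub_le (g := g) (G := G) (a := x) (d := d) H (C := ε)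
    (fun s hs => hg _ (by
      rw [mem_ball_iff_norm, add_sub_cancel_left]
      exact (hs' s hs).trans_lt (hdn.trans_le (min_le_right _ _))))
    (fun s hs => by
      have := h3 (s • d) (by
        rw [mem_ball_iff_norm, sub_zero]
        exact (hs' s hs).trans_lt (hdn.trans_le (min_le_left _ _)))
      simpa [norm_smul, abs_of_nonneg hs.1, mul_assoc] using this)
  refine h4.trans ?_
  gcongr
  linarith

/-- A function with Lipschitz gradient that has a second-order Taylor expansion at `x` has a
gradient that is differentiable at `x`. With `D = ∇g(y) - ∇g(x) - H (y - x)`, the expansion bounds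
the increment of the remainder from `y` to `y + e` by `o(‖y - x‖²)`, while the descent lemma at
`y` shows that this increment is `⟪D, e⟫` up to `O(‖e‖²)`; the choice of `e` parallel to `D` of
length `δ ‖y - x‖` bounds `‖D‖`. -/
theorem hasFDerivAt_gradient_of_taylor (hr : 0 < r) (hL : 0 ≤ L)
    (hg : ∀ y ∈ Metric.ball x r, HasGradientAt g (G y) y)
    (hG : ∀ y ∈ Metric.ball x r, ∀ z ∈ Metric.ball x r, ‖G y - G z‖ ≤ L * ‖y - z‖)
    {H : E →L[ℝ] E} (hsymm : ∀ u v, inner ℝ (H u) v = inner ℝ (H v) u)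
    (hT : ∀ ε > 0, ∀ᶠ d in 𝓝 (0 : E),
      |g (x + d) - g x - inner ℝ (G x) d - (1 / 2) * inner ℝ (H d) d| ≤ ε * ‖d‖ ^ 2) :
    HasFDerivAt G H x := by
  rw [hasFDerivAt_iff_isLittleO_nhds_zero, Asymptotics.isLittleO_iff]
  intro η hη
  set C : ℝ := L + ‖H‖ with hCdef
  have hC : 0 ≤ C := by positivity
  obtain ⟨δ, hδ, hδ1, hδC⟩ : ∃ δ : ℝ, 0 < δ ∧ δ ≤ 1 ∧ C * δ ≤ η := by
    refine ⟨min 1 (η / (C + 1)), by positivity, min_le_left _ _, ?_⟩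
    calc C * min 1 (η / (C + 1)) ≤ (C + 1) * (η / (C + 1)) := by
          gcongr
          · linarith
          · exact min_le_right _ _
      _ = η := by field_simp
  obtain ⟨ρ, hρ, hTρ⟩ := Metric.eventually_nhds_iff_ball.1 (hT (η * δ / 10) (by positivity))
  filter_upwards [Metric.ball_mem_nhds (0 : E) (show 0 < min ρ r / 2 by positivity)] with d hd
  set D : E := G (x + d) - G x - H d with hD
  have hdn : ‖d‖ < min ρ r / 2 := by simpa using hd
  have hρr := min_le_left ρ r
  have hρr' := min_le_right ρ r
  by_cases hD0 : D = 0
  · rw [hD0, norm_zero]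
    positivity
  have hDpos : 0 < ‖D‖ := norm_pos_iff.2 hD0
  by_cases hd0 : d = 0
  · exact absurd (by rw [hD, hd0]; simp) hD0
  have hdpos : 0 < ‖d‖ := norm_pos_iff.2 hd0
  set e : E := (δ * ‖d‖ / ‖D‖) • D with he
  have hen : ‖e‖ = δ * ‖d‖ := by
    rw [he, norm_smul, Real.norm_of_nonneg (by positivity)]
    field_simp
  have hDe : inner ℝ D e = δ * ‖d‖ * ‖D‖ := by
    rw [he, real_inner_smul_right, real_inner_self_eq_norm_sq]
    field_simp
  have hed : ‖e‖ ≤ ‖d‖ := by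
    rw [hen]
    exact mul_le_of_le_one_left hdpos.le hδ1
  have hsum : ‖d + e‖ ≤ 2 * ‖d‖ := (norm_add_le _ _).trans (by linarith)
  have h1 := hTρ d (by rw [mem_ball_iff_norm, sub_zero]; linarith)
  have h2 := hTρ (d + e) (by rw [mem_ball_iff_norm, sub_zero]; linarith)
  have h3 := abs_sub_sub_inner_le_of_lipschitz hg hG (a := x + d) (d := e)
    (by rw [mem_ball_iff_norm, add_sub_cancel_left]; linarith)
    (by rw [add_assoc, mem_ball_iff_norm, add_sub_cancel_left]; linarith)
  have h4 : |inner ℝ (H e) e| ≤ ‖H‖ * ‖e‖ ^ 2 := by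
    calc |inner ℝ (H e) e| ≤ ‖H e‖ * ‖e‖ := abs_real_inner_le_norm _ _
      _ ≤ ‖H‖ * ‖e‖ * ‖e‖ := by
          gcongr
          exact H.le_opNorm e
      _ = ‖H‖ * ‖e‖ ^ 2 := by ring
  have h5 : ‖d + e‖ ^ 2 ≤ 4 * ‖d‖ ^ 2 := by
    calc ‖d + e‖ ^ 2 ≤ (2 * ‖d‖) ^ 2 := by gcongr
      _ = 4 * ‖d‖ ^ 2 := by ring
  have h6 : η * δ / 10 * ‖d + e‖ ^ 2 ≤ η * δ / 10 * (4 * ‖d‖ ^ 2) := by gcongr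
  have hexp : inner ℝ (H (d + e)) (d + e)
      = inner ℝ (H d) d + 2 * inner ℝ (H d) e + inner ℝ (H e) e := by
    rw [map_add, inner_add_left, inner_add_right, inner_add_right, hsymm e d]
    ring
  have hDe' : inner ℝ D e = inner ℝ (G (x + d)) e - inner ℝ (G x) e - inner ℝ (H d) e := by
    rw [hD, inner_sub_left, inner_sub_left]
  have hGx : inner ℝ (G x) (d + e) = inner ℝ (G x) d + inner ℝ (G x) e := inner_add_right _ _ _
  rw [hexp, hGx] at h2
  rw [add_assoc] at h3
  rw [abs_le] at h1 h2 h3 h4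
  have h7 : δ * ‖d‖ * ‖D‖ ≤ η * δ / 2 * ‖d‖ ^ 2 + C / 2 * ‖e‖ ^ 2 := by
    rw [← hDe, hDe', hCdef]
    linarith [h1.1, h1.2, h2.1, h2.2, h3.1, h3.2, h4.1, h4.2]
  rw [hen] at h7
  have h8 : (δ * ‖d‖) * ‖D‖ ≤ (δ * ‖d‖) * (η * ‖d‖) := by
    calc (δ * ‖d‖) * ‖D‖ ≤ η * δ / 2 * ‖d‖ ^ 2 + C / 2 * (δ * ‖d‖) ^ 2 := h7
      _ = η * δ / 2 * ‖d‖ ^ 2 + (C * δ) * (δ * ‖d‖ ^ 2 / 2) := by ring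
      _ ≤ η * δ / 2 * ‖d‖ ^ 2 + η * (δ * ‖d‖ ^ 2 / 2) := by gcongr
      _ = (δ * ‖d‖) * (η * ‖d‖) := by ring
  exact le_of_mul_le_mul_left h8 (by positivity)

end Taylor

/-! ### Epi-convergence from continuous convergence -/

/-- Continuous convergence `F t w' → q w` as `w' → w` implies epi-convergence. -/
theorem epiTendsto_of_tendsto_prod {n : ℕ} {T : Type*} {l : Filter T} [l.NeBot]
    {F : T → Rn n → EReal} {q : Rn n → EReal}
    (h : ∀ w, Tendsto (fun p : T × Rn n => F p.1 p.2) (l ×ˢ 𝓝 w) (𝓝 (q w))) :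
    EpiTendsto F l q := by
  have hio : innerLimit l (fun t => epigraph (F t)) ⊆ outerLimit l (fun t => epigraph (F t)) :=
    fun z hz V hV => (hz V hV).frequently
  have ho : outerLimit l (fun t => epigraph (F t)) ⊆ epigraph q := by
    rintro ⟨w, α⟩ hz
    by_contra hlt
    obtain ⟨β, hαβ, hβ⟩ := EReal.lt_iff_exists_real_btwn.1 (not_le.1 hlt)
    obtain ⟨P, hP, W, hW, hPW⟩ := eventually_prod_iff.1 ((h w).eventually (lt_mem_nhds hβ))
    have hV : {w' | W w'} ×ˢ Set.Iio β ∈ 𝓝 (w, α) :=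
      prod_mem_nhds hW (Iio_mem_nhds (EReal.coe_lt_coe_iff.1 hαβ))
    obtain ⟨t, ⟨⟨w', α'⟩, hle, hw', hα'⟩, ht⟩ := ((hz _ hV).and_eventually hP).exists
    have h1 : F t w' ≤ (α' : EReal) := hle
    exact absurd ((hPW ht hw').trans_le h1) (not_lt.2 (EReal.coe_le_coe_iff.2 (le_of_lt hα')))
  have hi : epigraph q ⊆ innerLimit l (fun t => epigraph (F t)) := by
    rintro ⟨w, α⟩ hz V hV
    obtain ⟨V₁, hV₁, V₂, hV₂, hV'⟩ := mem_nhds_prod_iff.1 hV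
    obtain ⟨ε, hε, hball⟩ := Metric.mem_nhds_iff.1 hV₂
    have hz' : q w ≤ (α : EReal) := hz
    have hlt : q w < ((α + ε / 2 : ℝ) : EReal) :=
      hz'.trans_lt (EReal.coe_lt_coe_iff.2 (by linarith))
    have hw : Tendsto (fun t => F t w) l (𝓝 (q w)) :=
      (h w).comp (tendsto_id.prodMk tendsto_const_nhds)
    filter_upwards [hw.eventually (gt_mem_nhds hlt)] with t ht
    refine ⟨(w, α + ε / 2), ht.le, hV' ⟨mem_of_mem_nhds hV₁, hball ?_⟩⟩
    rw [Real.ball_eq_Ioo]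
    constructor <;> linarith
  exact ⟨ho.antisymm (hi.trans hio), (hio.trans ho).antisymm hi⟩

/-! ### Second-order difference quotients near a point of finiteness -/

/-- The second-order difference quotient of a real-valued function. -/
noncomputable def realQuotient {n : ℕ} (g : Rn n → ℝ) (x v : Rn n) (t : ℝ) (w : Rn n) : ℝ :=
  (g (x + t • w) - g x - t * inner ℝ v w) / ((1 / 2) * t ^ 2)

theorem tendsto_add_smul {n : ℕ} (x w : Rn n) :
    Tendsto (fun p : ℝ × Rn n => x + p.1 • p.2) (𝓝[>] (0 : ℝ) ×ˢ 𝓝 w) (𝓝 x) := by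
  have h : Tendsto (fun p : ℝ × Rn n => x + p.1 • p.2) (𝓝 ((0 : ℝ), w)) (𝓝 (x + (0 : ℝ) • w)) :=
    Continuous.tendsto (by fun_prop) _
  rw [zero_smul, add_zero, nhds_prod_eq] at h
  exact h.mono_left (Filter.prod_mono nhdsWithin_le_nhds le_rfl)

theorem eventually_pos_prod {n : ℕ} (w : Rn n) :
    ∀ᶠ p : ℝ × Rn n in 𝓝[>] (0 : ℝ) ×ˢ 𝓝 w, 0 < p.1 :=
  tendsto_fst.eventually (eventually_mem_nhdsWithin (a := (0 : ℝ)) (s := Set.Ioi 0))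

theorem secondQuotient_eq_realQuotient {n : ℕ} {f : Rn n → EReal} {x : Rn n}
    (hx : f x ≠ ⊥ ∧ f x ≠ ⊤) {t : ℝ} {w : Rn n}
    (hy : f (x + t • w) ≠ ⊥ ∧ f (x + t • w) ≠ ⊤) (v : Rn n) :
    secondQuotient f x v t w = (realQuotient (fun y => (f y).toReal) x v t w : EReal) := by
  rw [secondQuotient, realQuotient, EReal.coe_div, EReal.coe_sub, EReal.coe_sub,
    EReal.coe_toReal hx.2 hx.1, EReal.coe_toReal hy.2 hy.1]

theorem eventually_secondQuotient_eq {n : ℕ} {f : Rn n → EReal} {x : Rn n}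
    (hf : ∀ᶠ y in 𝓝 x, f y ≠ ⊥ ∧ f y ≠ ⊤) (v w : Rn n) :
    ∀ᶠ p : ℝ × Rn n in 𝓝[>] (0 : ℝ) ×ˢ 𝓝 w, secondQuotient f x v p.1 p.2
      = (realQuotient (fun y => (f y).toReal) x v p.1 p.2 : EReal) := by
  filter_upwards [(tendsto_add_smul x w).eventually hf] with p hp
  exact secondQuotient_eq_realQuotient hf.self_of_nhds hp v

section Lipschitz

variable {n : ℕ} {g : Rn n → ℝ} {G : Rn n → Rn n} {x : Rn n} {r L : ℝ}

theorem abs_realQuotient_le_of_lipschitz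
    (hg : ∀ y ∈ Metric.ball x r, HasGradientAt g (G y) y)
    (hG : ∀ y ∈ Metric.ball x r, ∀ z ∈ Metric.ball x r, ‖G y - G z‖ ≤ L * ‖y - z‖)
    {t : ℝ} (ht : 0 < t) {w : Rn n} (hw : x + t • w ∈ Metric.ball x r) :
    |realQuotient g x (G x) t w| ≤ L * ‖w‖ ^ 2 := by
  have h := abs_sub_sub_inner_le_of_lipschitz hg hG
    (Metric.mem_ball_self (dist_nonneg.trans_lt hw)) hw
  rw [real_inner_smul_right, norm_smul, Real.norm_of_nonneg ht.le] at h
  have ht2 : 0 < (1 / 2) * t ^ 2 := by positivity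
  rw [realQuotient, abs_div, abs_of_pos ht2, div_le_iff₀ ht2]
  linarith

/-- The difference quotients are Lipschitz on balls, with a constant independent of `t`. -/
theorem abs_realQuotient_sub_le (hL : 0 ≤ L)
    (hg : ∀ y ∈ Metric.ball x r, HasGradientAt g (G y) y)
    (hG : ∀ y ∈ Metric.ball x r, ∀ z ∈ Metric.ball x r, ‖G y - G z‖ ≤ L * ‖y - z‖)
    {t R : ℝ} (ht : 0 < t) (htR : t * R ≤ r) {a b : Rn n} (ha : ‖a‖ < R) (hb : ‖b‖ < R) :
    |realQuotient g x (G x) t b - realQuotient g x (G x) t a| ≤ 2 * L * R * ‖b - a‖ := by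
  have hmem : ∀ c : Rn n, ‖c‖ < R → x + t • c ∈ Metric.ball x (t * R) := by
    intro c hc
    rw [mem_ball_iff_norm, add_sub_cancel_left, norm_smul, Real.norm_of_nonneg ht.le]
    gcongr
  have h := abs_sub_sub_inner_center_le hL hg hG htR (hmem a ha) (hmem b hb)
  rw [add_sub_add_left_eq_sub, ← smul_sub, real_inner_smul_right, norm_smul,
    Real.norm_of_nonneg ht.le, inner_sub_right] at h
  have ht2 : 0 < (1 / 2) * t ^ 2 := by positivity
  rw [realQuotient, realQuotient, ← sub_div, abs_div, abs_of_pos ht2, div_le_iff₀ ht2]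
  calc _ = |g (x + t • b) - g (x + t • a) - t * (inner ℝ (G x) b - inner ℝ (G x) a)| := by
        congr 1
        ring
    _ ≤ L * (t * R) * (t * ‖b - a‖) := h
    _ = _ := by ring

/-- Under the Taylor expansion with Hessian `H`, the difference quotients converge continuously to
`⟨H w, w⟩`. -/
theorem tendsto_realQuotient_of_taylor {v : Rn n} {H : Rn n →L[ℝ] Rn n}
    (hT : ∀ ε > 0, ∀ᶠ d in 𝓝 (0 : Rn n),
      |g (x + d) - g x - inner ℝ v d - (1 / 2) * inner ℝ (H d) d| ≤ ε * ‖d‖ ^ 2) (w : Rn n) :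
    Tendsto (fun p : ℝ × Rn n => realQuotient g x v p.1 p.2) (𝓝[>] (0 : ℝ) ×ˢ 𝓝 w)
      (𝓝 (inner ℝ (H w) w)) := by
  have hq : Tendsto (fun p : ℝ × Rn n => inner ℝ (H p.2) p.2) (𝓝[>] (0 : ℝ) ×ˢ 𝓝 w)
      (𝓝 (inner ℝ (H w) w)) := by
    have hc : Continuous fun w : Rn n => inner ℝ (H w) w := by fun_prop
    exact (hc.tendsto w).comp tendsto_snd
  have hrem : Tendsto (fun p : ℝ × Rn n => realQuotient g x v p.1 p.2 - inner ℝ (H p.2) p.2)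
      (𝓝[>] (0 : ℝ) ×ˢ 𝓝 w) (𝓝 0) := by
    rw [Metric.tendsto_nhds]
    intro ε hε
    set K : ℝ := ‖w‖ ^ 2 + 1 with hK
    have hKpos : 0 < K := by positivity
    have hbd : ∀ᶠ p : ℝ × Rn n in 𝓝[>] (0 : ℝ) ×ˢ 𝓝 w, ‖p.2‖ ^ 2 < K := by
      have hc : Continuous fun w : Rn n => ‖w‖ ^ 2 := by fun_prop
      exact tendsto_snd.eventually ((hc.tendsto w).eventually (gt_mem_nhds (by linarith)))
    have h0 := tendsto_add_smul (0 : Rn n) w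
    simp only [zero_add] at h0
    filter_upwards [h0.eventually (hT (ε / (4 * K)) (by positivity)), eventually_pos_prod w, hbd]
      with p hp hpos hpK
    have ht2 : 0 < (1 / 2) * p.1 ^ 2 := by positivity
    rw [map_smul, real_inner_smul_right, real_inner_smul_right, real_inner_smul_left, norm_smul,
      Real.norm_of_nonneg hpos.le] at hp
    have heq : realQuotient g x v p.1 p.2 - inner ℝ (H p.2) p.2
        = (g (x + p.1 • p.2) - g x - p.1 * inner ℝ v p.2
          - 1 / 2 * (p.1 * (p.1 * inner ℝ (H p.2) p.2))) / ((1 / 2) * p.1 ^ 2) := by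
      rw [realQuotient]
      field_simp
    rw [dist_zero_right, Real.norm_eq_abs, heq, abs_div, abs_of_pos ht2, div_lt_iff₀ ht2]
    calc _ ≤ ε / (4 * K) * (p.1 * ‖p.2‖) ^ 2 := hp
      _ = ε / (4 * K) * ‖p.2‖ ^ 2 * p.1 ^ 2 := by ring
      _ ≤ ε / (4 * K) * K * p.1 ^ 2 := by gcongr
      _ = ε / 4 * p.1 ^ 2 := by field_simp
      _ < ε * (1 / 2 * p.1 ^ 2) := by nlinarith [pow_pos hpos 2]
  simpa using hrem.add hq

/-- Conversely, continuous convergence of the difference quotients to `⟨H w, w⟩` gives the Taylor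
expansion, since the convergence is uniform on the compact unit sphere. -/
theorem taylor_of_tendsto_realQuotient {v : Rn n} {H : Rn n →L[ℝ] Rn n}
    (h : ∀ w, Tendsto (fun p : ℝ × Rn n => realQuotient g x v p.1 p.2) (𝓝[>] (0 : ℝ) ×ˢ 𝓝 w)
      (𝓝 (inner ℝ (H w) w))) :
    ∀ ε > 0, ∀ᶠ d in 𝓝 (0 : Rn n),
      |g (x + d) - g x - inner ℝ v d - (1 / 2) * inner ℝ (H d) d| ≤ ε * ‖d‖ ^ 2 := by
  intro ε hε
  have hc : Continuous fun w : Rn n => inner ℝ (H w) w := by fun_prop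
  have hunif : TendstoUniformlyOn (fun t w => realQuotient g x v t w)
      (fun w => inner ℝ (H w) w) (𝓝[>] (0 : ℝ)) (Metric.sphere (0 : Rn n) 1) := by
    rw [← tendstoLocallyUniformlyOn_iff_tendstoUniformlyOn_of_compact (isCompact_sphere _ _),
      tendstoLocallyUniformlyOn_iff_forall_tendsto]
    intro w _
    refine Tendsto.mono_right (Tendsto.mono_left ?_
      (Filter.prod_mono le_rfl nhdsWithin_le_nhds)) (nhds_le_uniformity (inner ℝ (H w) w))
    rw [nhds_prod_eq]
    exact ((hc.tendsto w).comp tendsto_snd).prodMk (h w)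
  have hU := Metric.tendstoUniformlyOn_iff.1 hunif ε hε
  rw [eventually_nhdsWithin_iff] at hU
  have hnorm : Tendsto (fun d : Rn n => ‖d‖) (𝓝 0) (𝓝 0) := tendsto_norm_zero
  filter_upwards [hnorm.eventually hU] with d hd
  by_cases hd0 : d = 0
  · simp [hd0]
  have hpos : 0 < ‖d‖ := norm_pos_iff.2 hd0
  have ht2 : 0 < (1 / 2) * ‖d‖ ^ 2 := by positivity
  have hd' := hd hpos (‖d‖⁻¹ • d) (by
    rw [mem_sphere_zero_iff_norm, norm_smul, norm_inv, norm_norm, inv_mul_cancel₀ hpos.ne'])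
  rw [dist_comm, Real.dist_eq, realQuotient, smul_inv_smul₀ hpos.ne', map_smul,
    real_inner_smul_right, real_inner_smul_right, real_inner_smul_left,
    mul_inv_cancel_left₀ hpos.ne'] at hd'
  have heq : (g (x + d) - g x - inner ℝ v d) / ((1 / 2) * ‖d‖ ^ 2)
      - ‖d‖⁻¹ * (‖d‖⁻¹ * inner ℝ (H d) d)
      = (g (x + d) - g x - inner ℝ v d - (1 / 2) * inner ℝ (H d) d) / ((1 / 2) * ‖d‖ ^ 2) := by
    field_simp
  rw [heq, abs_div, abs_of_pos ht2, div_lt_iff₀ ht2] at hd'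
  nlinarith [pow_pos hpos 2]

end Lipschitz

/-! ### Symmetric operators and quadratic forms -/

theorem gradient_derivative_symmetric {E : Type*} [NormedAddCommGroup E] [InnerProductSpace ℝ E]
    [CompleteSpace E] {g : E → ℝ} {G : E → E} {x : E} {H : E →L[ℝ] E}
    (hg : ∀ᶠ y in 𝓝 x, HasGradientAt g (G y) y) (hH : HasFDerivAt G H x) (u v : E) :
    inner ℝ (H u) v = inner ℝ (H v) u := by
  -- The Riesz map `InnerProductSpace.toDual`, as a linear rather than conjugate-linear map.
  let B : E →L[ℝ] E →L[ℝ] ℝ := (innerₗ E).mkContinuous₂ 1 fun a b => by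
    simpa using norm_inner_le_norm (𝕜 := ℝ) a b
  have hev : ∀ᶠ y in 𝓝 x, HasFDerivAt g (B (G y)) y := hg.mono fun y hy =>
    hy.hasFDerivAt.congr_fderiv (by ext z; rfl)
  exact second_derivative_symmetric_of_eventually hev (B.hasFDerivAt.comp x hH) u v

/-- The factor `1 / 2` in the definition of a generalized quadratic form makes `2 H` the matrix of
`w ↦ ⟨H w, w⟩`. -/
theorem isGeneralizedQuadraticForm_of_symmetric {n : ℕ} {H : Rn n →L[ℝ] Rn n}
    (hsymm : ∀ u v, inner ℝ (H u) v = inner ℝ (H v) u) :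
    IsGeneralizedQuadraticForm fun w => ((inner ℝ (H w) w : ℝ) : EReal) := by
  obtain ⟨A, hA⟩ := (Matrix.toEuclideanLin (𝕜 := ℝ) (m := Fin n) (n := Fin n)).surjective
    ((2 : ℝ) • (H : Rn n →ₗ[ℝ] Rn n))
  have happ : ∀ w, Matrix.toEuclideanLin A w = (2 : ℝ) • H w := fun w => by rw [hA]; rfl
  refine ⟨A, ⊤, ?_, fun w => ?_⟩
  · have hherm : A.IsHermitian := by
      rw [← Matrix.isSymmetric_toEuclideanLin_iff]
      intro u v
      rw [happ, happ, real_inner_smul_left, real_inner_smul_right, hsymm u v, real_inner_comm]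
    rwa [Matrix.IsHermitian, Matrix.conjTranspose_eq_transpose_of_trivial] at hherm
  · change ((inner ℝ (H w) w : ℝ) : EReal) = _
    rw [happ, real_inner_smul_right, indicatorFun, if_pos (by simp), add_zero,
      real_inner_comm (H w) w, EReal.coe_eq_coe_iff]
    ring

/-- The subspace of a generalized quadratic form that is finite everywhere is the whole space. -/
theorem IsGeneralizedQuadraticForm.exists_symmetric {n : ℕ} {q : Rn n → EReal}
    (hq : IsGeneralizedQuadraticForm q) (hfin : ∀ w, q w ≠ ⊤) :
    ∃ H : Rn n →L[ℝ] Rn n, (∀ u v, inner ℝ (H u) v = inner ℝ (H v) u) ∧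
      ∀ w, q w = ((inner ℝ (H w) w : ℝ) : EReal) := by
  obtain ⟨A, M, hA, hq⟩ := hq
  have hAs : (Matrix.toEuclideanLin A).IsSymmetric := by
    rw [Matrix.isSymmetric_toEuclideanLin_iff, Matrix.IsHermitian,
      Matrix.conjTranspose_eq_transpose_of_trivial]
    exact hA
  obtain ⟨H, hH⟩ : ∃ H : Rn n →L[ℝ] Rn n, ∀ w, H w = (1 / 2 : ℝ) • Matrix.toEuclideanLin A w :=
    ⟨(1 / 2 : ℝ) • (Matrix.toEuclideanLin A).toContinuousLinearMap, fun _ => rfl⟩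
  refine ⟨H, fun u v => ?_, fun w => ?_⟩
  · rw [hH, hH, real_inner_smul_left, real_inner_smul_left, hAs u v, real_inner_comm]
  · have h := hq w
    by_cases hw : w ∈ (M : Set (Rn n))
    · rw [h, indicatorFun, if_pos hw, add_zero, hH, real_inner_smul_left, real_inner_comm]
    · rw [indicatorFun, if_neg hw, EReal.coe_add_top] at h
      exact absurd h (hfin w)

/-! ### The second subderivative of a function with Lipschitz gradient -/

section Subderiv

variable {n : ℕ} {f : Rn n → EReal} {G : Rn n → Rn n} {x : Rn n} {r L : ℝ}

theorem exists_secondSubderiv_eq_coe (hr : 0 < r)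
    (hf : ∀ᶠ y in 𝓝 x, f y ≠ ⊥ ∧ f y ≠ ⊤)
    (hg : ∀ y ∈ Metric.ball x r, HasGradientAt (fun y => (f y).toReal) (G y) y)
    (hG : ∀ y ∈ Metric.ball x r, ∀ z ∈ Metric.ball x r, ‖G y - G z‖ ≤ L * ‖y - z‖) (w : Rn n) :
    ∃ α : ℝ, secondSubderiv f x (G x) w = α ∧ |α| ≤ L * ‖w‖ ^ 2 := by
  have hbd : ∀ᶠ p : ℝ × Rn n in 𝓝[>] (0 : ℝ) ×ˢ 𝓝 w,
      ((-(L * ‖p.2‖ ^ 2) : ℝ) : EReal) ≤ secondQuotient f x (G x) p.1 p.2 ∧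
        secondQuotient f x (G x) p.1 p.2 ≤ ((L * ‖p.2‖ ^ 2 : ℝ) : EReal) := by
    filter_upwards [eventually_secondQuotient_eq hf (G x) w, eventually_pos_prod w,
      (tendsto_add_smul x w).eventually (Metric.ball_mem_nhds x hr)] with p hp hpos hball
    have h := abs_le.1 (abs_realQuotient_le_of_lipschitz hg hG hpos hball)
    rw [hp, EReal.coe_le_coe_iff, EReal.coe_le_coe_iff]
    exact h
  have hlim : Tendsto (fun p : ℝ × Rn n => L * ‖p.2‖ ^ 2) (𝓝[>] (0 : ℝ) ×ˢ 𝓝 w)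
      (𝓝 (L * ‖w‖ ^ 2)) := by
    have hc : Continuous fun w : Rn n => L * ‖w‖ ^ 2 := by fun_prop
    exact (hc.tendsto w).comp tendsto_snd
  have hlow : ((-(L * ‖w‖ ^ 2) : ℝ) : EReal) ≤ secondSubderiv f x (G x) w := by
    rw [← (EReal.tendsto_coe.2 hlim.neg).liminf_eq]
    exact liminf_le_liminf (hbd.mono fun p hp => hp.1)
  have hup : secondSubderiv f x (G x) w ≤ ((L * ‖w‖ ^ 2 : ℝ) : EReal) := by
    rw [← (EReal.tendsto_coe.2 hlim).liminf_eq]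
    exact liminf_le_liminf (hbd.mono fun p hp => hp.2)
  generalize secondSubderiv f x (G x) w = e at hlow hup
  induction e with
  | bot => exact absurd (le_bot_iff.1 hlow) (EReal.coe_ne_bot _)
  | top => exact absurd (top_le_iff.1 hup) (EReal.coe_ne_top _)
  | coe α => exact ⟨α, rfl, abs_le.2 ⟨EReal.coe_le_coe_iff.1 hlow, EReal.coe_le_coe_iff.1 hup⟩⟩

/-- Twice epi-differentiability improves to continuous convergence of the difference quotients,
because these are Lipschitz on bounded sets uniformly in `t`. The lower estimate is the definition
of the second subderivative as a lower limit; the upper one moves the recovery points provided by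
the inner limit of the epigraphs to arbitrary nearby points. -/
theorem TwiceEpiDifferentiableAt.tendsto_realQuotient (hr : 0 < r) (hL : 0 ≤ L)
    (hf : ∀ᶠ y in 𝓝 x, f y ≠ ⊥ ∧ f y ≠ ⊤)
    (hg : ∀ y ∈ Metric.ball x r, HasGradientAt (fun y => (f y).toReal) (G y) y)
    (hG : ∀ y ∈ Metric.ball x r, ∀ z ∈ Metric.ball x r, ‖G y - G z‖ ≤ L * ‖y - z‖)
    (hepi : TwiceEpiDifferentiableAt f x (G x)) {w : Rn n} {α : ℝ}
    (hα : secondSubderiv f x (G x) w = α) :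
    Tendsto (fun p : ℝ × Rn n => realQuotient (fun y => (f y).toReal) x (G x) p.1 p.2)
      (𝓝[>] (0 : ℝ) ×ˢ 𝓝 w) (𝓝 α) := by
  rw [tendsto_order]
  constructor
  · intro β hβ
    have h : (β : EReal) < secondSubderiv f x (G x) w := by
      rw [hα]
      exact EReal.coe_lt_coe_iff.2 hβ
    filter_upwards [eventually_lt_of_lt_liminf h, eventually_secondQuotient_eq hf (G x) w]
      with p hp hp'
    rw [hp'] at hp
    exact EReal.coe_lt_coe_iff.1 hp
  · intro β hβ
    set R : ℝ := ‖w‖ + 1 with hR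
    have hRpos : 0 < R := by positivity
    -- `κ` is so small that recovery points within `κ` of `w` and values within `κ` of `α` give
    -- `α + κ + 2 L R (2 κ) < β` after the Lipschitz estimate.
    obtain ⟨κ, hκ, hκ1, hκβ⟩ : ∃ κ : ℝ, 0 < κ ∧ κ ≤ 1 ∧ κ + 2 * L * R * (2 * κ) < β - α := by
      have hd : 0 < β - α := sub_pos.2 hβ
      have hK : 0 < 2 * (1 + 4 * L * R) := by positivity
      refine ⟨min 1 ((β - α) / (2 * (1 + 4 * L * R))), by positivity, min_le_left _ _, ?_⟩
      have h := (le_div_iff₀ hK).1 (min_le_right 1 ((β - α) / (2 * (1 + 4 * L * R))))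
      linarith
    have hmem : (w, α) ∈ innerLimit (𝓝[>] (0 : ℝ))
        (fun t => epigraph (secondQuotient f x (G x) t)) := by
      rw [hepi.2]
      exact hα.le
    have hrec := hmem (Metric.ball w κ ×ˢ Metric.ball α κ)
      (prod_mem_nhds (Metric.ball_mem_nhds _ hκ) (Metric.ball_mem_nhds _ hκ))
    obtain ⟨ρ, hρ, hfρ⟩ := Metric.eventually_nhds_iff_ball.1 hf
    have hsmall : ∀ᶠ t in 𝓝[>] (0 : ℝ), t * R < min ρ r := by
      have hc : Continuous fun t : ℝ => t * R := by fun_prop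
      have h0 := hc.tendsto 0
      rw [zero_mul] at h0
      exact (h0.mono_left nhdsWithin_le_nhds).eventually (gt_mem_nhds (lt_min hρ hr))
    filter_upwards [tendsto_fst.eventually hrec, tendsto_fst.eventually hsmall,
      eventually_pos_prod w, tendsto_snd.eventually (Metric.ball_mem_nhds w hκ)]
      with p hp hpR hpos hpw
    obtain ⟨⟨w', α'⟩, hle, hw', hα'⟩ := hp
    have hnear : ∀ c ∈ Metric.ball w κ, ‖c‖ < R := by
      intro c hc
      have h1 := mem_ball_iff_norm.1 hc
      have h2 := norm_le_norm_add_norm_sub' c w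
      linarith
    have hw'R := hnear w' hw'
    have hle' : secondQuotient f x (G x) p.1 w' ≤ (α' : EReal) := hle
    rw [secondQuotient_eq_realQuotient hf.self_of_nhds (hfρ _ (by
      rw [mem_ball_iff_norm, add_sub_cancel_left, norm_smul, Real.norm_of_nonneg hpos.le]
      calc p.1 * ‖w'‖ ≤ p.1 * R := by gcongr
        _ < ρ := hpR.trans_le (min_le_left _ _))), EReal.coe_le_coe_iff] at hle'
    have hlip := (abs_le.1 (abs_realQuotient_sub_le hL hg hG hpos
      (hpR.le.trans (min_le_right _ _)) hw'R (hnear p.2 hpw))).2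
    have hdist : ‖p.2 - w'‖ ≤ 2 * κ := by
      rw [← dist_eq_norm]
      have h1 := Metric.mem_ball.1 hpw
      have h2 := Metric.mem_ball'.1 hw'
      linarith [dist_triangle p.2 w w']
    have hα'κ : α' < α + κ := by
      have h := (abs_lt.1 (Metric.mem_ball.1 hα')).2
      linarith
    have hmul : 2 * L * R * ‖p.2 - w'‖ ≤ 2 * L * R * (2 * κ) := by gcongr
    linarith

/-- The gradient at a point of differentiability is a limiting, in fact a regular, subgradient. -/
theorem mem_limitingSubdifferential_of_hasGradientAt {v : Rn n}
    (hf : ∀ᶠ y in 𝓝 x, f y ≠ ⊥ ∧ f y ≠ ⊤)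
    (hv : HasGradientAt (fun y => (f y).toReal) v x) : v ∈ limitingSubdifferential f x := by
  have hx := hf.self_of_nhds
  refine ⟨hx.2, fun _ => x, fun _ => v, tendsto_const_nhds, tendsto_const_nhds,
    fun _ => ⟨hx.2, ?_⟩⟩
  refine le_of_forall_lt fun c hc => ?_
  obtain ⟨b, hcb, hb⟩ := EReal.lt_iff_exists_real_btwn.1 hc
  have hb0 : b < 0 := by exact_mod_cast hb
  refine hcb.trans_le (le_liminf_of_le (by isBoundedDefault) ?_)
  have ho := (hasGradientAt_iff_isLittleO.1 hv).def (neg_pos.2 hb0)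
  filter_upwards [nhdsWithin_le_nhds ho, nhdsWithin_le_nhds hf, self_mem_nhdsWithin]
    with y hy hfy hyx
  have hpos : 0 < ‖y - x‖ := norm_pos_iff.2 (sub_ne_zero.2 hyx)
  have heq : (f y - f x - ((inner ℝ v (y - x) : ℝ) : EReal)) / ((‖y - x‖ : ℝ) : EReal)
      = ((((f y).toReal - (f x).toReal - inner ℝ v (y - x)) / ‖y - x‖ : ℝ) : EReal) := by
    rw [EReal.coe_div, EReal.coe_sub, EReal.coe_sub, EReal.coe_toReal hx.2 hx.1,
      EReal.coe_toReal hfy.2 hfy.1]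
  rw [heq, EReal.coe_le_coe_iff, le_div_iff₀ hpos]
  rw [Real.norm_eq_abs] at hy
  have := (abs_le.1 hy).1
  linarith

theorem generalizedTwiceDifferentiableAt_of_hasFDerivAt (hr : 0 < r)
    (hf : ∀ᶠ y in 𝓝 x, f y ≠ ⊥ ∧ f y ≠ ⊤)
    (hg : ∀ y ∈ Metric.ball x r, HasGradientAt (fun y => (f y).toReal) (G y) y)
    {H : Rn n →L[ℝ] Rn n} (hH : HasFDerivAt G H x) :
    GeneralizedTwiceDifferentiableAt f x (G x) := by
  have hsymm : ∀ u v, inner ℝ (H u) v = inner ℝ (H v) u :=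
    gradient_derivative_symmetric (Filter.mem_of_superset (Metric.ball_mem_nhds x hr) hg) hH
  have htend : ∀ w, Tendsto (fun p : ℝ × Rn n => secondQuotient f x (G x) p.1 p.2)
      (𝓝[>] (0 : ℝ) ×ˢ 𝓝 w) (𝓝 ((inner ℝ (H w) w : ℝ) : EReal)) := by
    intro w
    have hT := taylor_isLittleO_of_hasFDerivAt_gradient hr hg hH
    have hreal := EReal.tendsto_coe.2 
      (tendsto_realQuotient_of_taylor (g := fun y => (f y).toReal) hT w)
    exact hreal.congr' (EventuallyEq.symm (eventually_secondQuotient_eq hf (G x) w))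
  have hsub : ∀ w, secondSubderiv f x (G x) w = ((inner ℝ (H w) w : ℝ) : EReal) :=
    fun w => (htend w).liminf_eq
  refine ⟨mem_limitingSubdifferential_of_hasGradientAt hf (hg x (Metric.mem_ball_self hr)),
    epiTendsto_of_tendsto_prod fun w => ?_, ?_⟩
  · rw [hsub]
    exact htend w
  · rw [show secondSubderiv f x (G x) = _ from funext hsub]
    exact isGeneralizedQuadraticForm_of_symmetric hsymm

theorem differentiableAt_gradient_of_generalizedTwiceDifferentiableAt (hr : 0 < r) (hL : 0 ≤ L)
    (hf : ∀ᶠ y in 𝓝 x, f y ≠ ⊥ ∧ f y ≠ ⊤)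
    (hg : ∀ y ∈ Metric.ball x r, HasGradientAt (fun y => (f y).toReal) (G y) y)
    (hG : ∀ y ∈ Metric.ball x r, ∀ z ∈ Metric.ball x r, ‖G y - G z‖ ≤ L * ‖y - z‖)
    (hgen : GeneralizedTwiceDifferentiableAt f x (G x)) : DifferentiableAt ℝ G x := by
  obtain ⟨-, hepi, hq⟩ := hgen
  obtain ⟨H, hsymm, hsub⟩ := hq.exists_symmetric fun w => by
    obtain ⟨α, hα, -⟩ := exists_secondSubderiv_eq_coe hr hf hg hG w
    rw [hα]
    exact EReal.coe_ne_top α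
  have hT := taylor_of_tendsto_realQuotient
    fun w => hepi.tendsto_realQuotient hr hL hf hg hG (hsub w)
  exact (hasFDerivAt_gradient_of_taylor hr hL hg hG hsymm hT).differentiableAt

end Subderiv

end VarAnalysis

theorem mainTheorem4 (n : ℕ) (f : VarAnalysis.Rn n → EReal) (hbot : ∀ x, f x ≠ ⊥)
    (U : Set (VarAnalysis.Rn n)) (hU : IsOpen U) (L : ℝ) (hL : 0 < L)
    (hdiff : ∀ x ∈ U, VarAnalysis.DiffAt f x)
    (hlip : ∀ x ∈ U, ∀ y ∈ U,
      ‖VarAnalysis.grad f x - VarAnalysis.grad f y‖ ≤ L * ‖x - y‖) :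
    (∀ x ∈ U, ∀ w : VarAnalysis.Rn n,
      VarAnalysis.secondSubderiv f x (VarAnalysis.grad f x) w ≠ ⊥ ∧
      VarAnalysis.secondSubderiv f x (VarAnalysis.grad f x) w ≠ ⊤ ∧
      (VarAnalysis.secondSubderiv f x (VarAnalysis.grad f x) w).abs ≤
        ENNReal.ofReal (L * ‖w‖ ^ 2)) ∧
    (∀ x ∈ U,
      VarAnalysis.GeneralizedTwiceDifferentiableAt f x (VarAnalysis.grad f x) ↔
        VarAnalysis.TwiceDiffAt f x) := by
  have hball : ∀ x ∈ U, ∃ r > 0,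
      (∀ y ∈ Metric.ball x r,
        HasGradientAt (fun y => (f y).toReal) (VarAnalysis.grad f y) y) ∧
      ∀ y ∈ Metric.ball x r, ∀ z ∈ Metric.ball x r,
        ‖VarAnalysis.grad f y - VarAnalysis.grad f z‖ ≤ L * ‖y - z‖ := by
    intro x hx
    obtain ⟨r, hr, hsub⟩ := Metric.isOpen_iff.1 hU x hx
    exact ⟨r, hr, fun y hy => (hdiff y (hsub hy)).2.hasGradientAt,
      fun y hy z hz => hlip y (hsub hy) z (hsub hz)⟩
  refine ⟨fun x hx w => ?_, fun x hx => ?_⟩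
  · obtain ⟨r, hr, hg, hG⟩ := hball x hx
    obtain ⟨α, hα, hle⟩ :=
      VarAnalysis.exists_secondSubderiv_eq_coe hr (hdiff x hx).1 hg hG w
    rw [hα, EReal.abs_def]
    exact ⟨EReal.coe_ne_bot α, EReal.coe_ne_top α, ENNReal.ofReal_le_ofReal hle⟩
  · obtain ⟨r, hr, hg, hG⟩ := hball x hx
    constructor
    · intro hgen
      exact ⟨Filter.mem_of_superset (hU.mem_nhds hx) hdiff,
        VarAnalysis.differentiableAt_gradient_of_generalizedTwiceDifferentiableAt hr hL.le
          (hdiff x hx).1 hg hG hgen⟩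
    · intro h
      exact VarAnalysis.generalizedTwiceDifferentiableAt_of_hasFDerivAt hr (hdiff x hx).1 hg
        h.2.hasFDerivAt
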